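/- **Setting.** Let $\mathbb X\subseteq\mathbb R$ be an interval and let $X=(X_t)_{t\ge 0}$ be a time-homogeneous continuous strong Markov process with values in $\mathbb X$; write $\mathbb P^x$, $\mathbb E^x$ for probability and expectation when $X_0=x$, where $x\mapsto\mathbb P^x$ is a probability kernel, and the strong Markov property is understood at all $[0,\infty]$-valued stopping times of the filtration generated by $X$. Let $f:\mathbb X\to[0,\infty)$ be continuous, and let $\delta:[0,\infty)\to(0,1]$ be non-increasing and continuous with $\delta(0)=1$, $\delta(t)\to0$ as $t\to\infty$, and $$\delta(s)\,\delta(t)\le\delta(s+t)\qquad\text{for all } s,t>0 .$$ For a Borel set $R\subseteq\mathbb X$ and $x\in\mathbb X$ let $\rho(R):=\inf\{t>0: X_t\in R\}$ (with $\inf\emptyset=\infty$) and $$J(x,R):=\mathbb E^x\big[\delta(\rho(R))\,f(X_{\rho(R)})\big]\in[0,\infty],\qquad V(x,R):=\max\{f(x),J(x,R)\},$$ where $\delta(\rho)f(X_\rho):=\limsup_{t\to\infty}\delta(t)f(X_t)$ on $\{\rho=\infty\}$. Put $$\Theta(R):=\{x\in\mathbb X: f(x)>J(x,R)\}\cup\big(\{x\in\mathbb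 X: f(x)=J(x,R)\}\cap R\big).$$ A Borel set $R\subseteq\mathbb X$ is an *equilibrium* if $\Theta(R)=R$. An equilibrium $\hat R$ is *optimal* if $V(x,\hat R)\ge V(x,R)$ for every equilibrium $R$ and every $x\in\mathbb X$. **Theorem.** Suppose that for every $x\in\mathbb X$: 1. $\mathbb P^x\big[\max_{0\le s\le t}X_s>x\big]=\mathbb P^x\big[\min_{0\le s\le t}X_s<x\big]=1$ for all $t>0$; 2. $\delta(t)f(X_t)\to0$ as $t\to\infty$, $\mathbb P^x$-a.s.; 3. $\mathbb E^x\big[\sup_{t\ge0}\delta(t)f(X_t)\big]<\infty$. Let $R^*$ be the intersection of all equilibria that are closed in $\mathbb X$. Then $R^*$ is an optimal equilibrium; that is, $R^*$ is an equilibrium and $V(x,R^*)\ge V(x,R)$ for every equilibrium $R$ and every $x\in\mathbb X$. -/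

import Mathlib

open MeasureTheory ProbabilityTheory Filter Topology
open scoped NNReal ENNReal

noncomputable section

namespace StopEq

variable {𝕏 : Set ℝ} {Ω : Type*} [MeasurableSpace Ω]

/-- `X` is a time-homogeneous continuous strong Markov process with values in `𝕏`, where `P x` is
the law `ℙ^x` of the process started at `x`. The strong Markov property is required at every
`[0, ∞]`-valued stopping time `τ` of the filtration generated by `X`: on `{τ < ∞}`, conditionally
on the past `ℱ_τ`, the path `s ↦ X (τ + s)` is distributed as the path of `X` under
`ℙ^y` with `y = X τ`. -/
structure IsContinuousStrongMarkov (P : Kernel 𝕏 Ω) (X : ℝ≥0 → Ω → 𝕏) : Prop where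
  measurable : ∀ t, Measurable (X t)
  continuous_path : ∀ ω, Continuous fun t => X t ω
  start : ∀ x : 𝕏, ∀ᵐ ω ∂(P x), X 0 ω = x
  strong_markov : ∀ (x : 𝕏) (τ : Ω → WithTop ℝ≥0)
    (hτ : IsStoppingTime
      (Filtration.natural X fun t => (measurable t).stronglyMeasurable) τ)
    (A : Set Ω), MeasurableSet[hτ.measurableSpace] A →
    ∀ B : Set (ℝ≥0 → 𝕏), MeasurableSet B →
      P x (A ∩ {ω | τ ω < ⊤} ∩ {ω | (fun s => X ((τ ω).untopD 0 + s) ω) ∈ B})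
        = ∫⁻ ω in A ∩ {ω | τ ω < ⊤},
            P (X ((τ ω).untopD 0) ω) {ω' | (fun s => X s ω') ∈ B} ∂(P x)

/-- The running maximum `max_{s ∈ [0,t]} X_s`. -/
def runningMax (X : ℝ≥0 → Ω → 𝕏) (t : ℝ≥0) (ω : Ω) : ℝ :=
  sSup ((fun s => (X s ω : ℝ)) '' Set.Icc 0 t)

/-- The running minimum `min_{s ∈ [0,t]} X_s`. -/
def runningMin (X : ℝ≥0 → Ω → 𝕏) (t : ℝ≥0) (ω : Ω) : ℝ :=
  sInf ((fun s => (X s ω : ℝ)) '' Set.Icc 0 t)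

/-- The process immediately goes strictly above and strictly below its starting point. -/
def IsDiffusive (P : Kernel 𝕏 Ω) (X : ℝ≥0 → Ω → 𝕏) : Prop :=
  ∀ (x : 𝕏) (t : ℝ≥0), 0 < t →
    P x {ω | (x : ℝ) < runningMax X t ω} = 1 ∧ P x {ω | runningMin X t ω < (x : ℝ)} = 1

/-- The standing conditions on a discount function `δ : [0, ∞) → (0, 1]`, including log
sub-additivity. -/
structure IsDiscount (δ : ℝ≥0 → ℝ≥0) : Prop where
  pos : ∀ t, 0 < δ t
  le_one : ∀ t, δ t ≤ 1
  antitone : Antitone δ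
  continuous : Continuous δ
  zero : δ 0 = 1
  tendsto_zero : Tendsto δ atTop (𝓝 0)
  log_subadditive : ∀ s t, 0 < s → 0 < t → δ s * δ t ≤ δ (s + t)

/-- The time `ρ = inf {t > 0 : X_t ∈ R}`, equal to `∞` if there is no such `t`. -/
def rho (X : ℝ≥0 → Ω → 𝕏) (R : Set 𝕏) (ω : Ω) : ℝ≥0∞ :=
  sInf ((fun t : ℝ≥0 => (t : ℝ≥0∞)) '' {t | 0 < t ∧ X t ω ∈ R})

/-- The discounted payoff `δ(τ) f(X_τ)` of stopping at `τ ∈ [0, ∞]`, read as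
`limsup_{t → ∞} δ(t) f(X_t)` if `τ = ∞`. -/
def payoff (X : ℝ≥0 → Ω → 𝕏) (f : 𝕏 → ℝ≥0) (δ : ℝ≥0 → ℝ≥0) (τ : ℝ≥0∞) (ω : Ω) : ℝ≥0∞ :=
  if τ = ∞ then limsup (fun t : ℝ≥0 => ((δ t * f (X t ω) : ℝ≥0) : ℝ≥0∞)) atTop
  else ((δ τ.toNNReal * f (X τ.toNNReal ω) : ℝ≥0) : ℝ≥0∞)

/-- The expected payoff `J(x, R) = 𝔼^x[δ(ρ) f(X_ρ)]`, possibly infinite. -/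
def J (P : Kernel 𝕏 Ω) (X : ℝ≥0 → Ω → 𝕏) (f : 𝕏 → ℝ≥0) (δ : ℝ≥0 → ℝ≥0)
    (x : 𝕏) (R : Set 𝕏) : ℝ≥0∞ :=
  ∫⁻ ω, payoff X f δ (rho X R ω) ω ∂(P x)

/-- The stopping region `S_R`. -/
def stoppingRegion (P : Kernel 𝕏 Ω) (X : ℝ≥0 → Ω → 𝕏) (f : 𝕏 → ℝ≥0) (δ : ℝ≥0 → ℝ≥0)
    (R : Set 𝕏) : Set 𝕏 :=
  {x | J P X f δ x R < (f x : ℝ≥0∞)}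

/-- The indifference region `I_R`. -/
def indifferenceRegion (P : Kernel 𝕏 Ω) (X : ℝ≥0 → Ω → 𝕏) (f : 𝕏 → ℝ≥0) (δ : ℝ≥0 → ℝ≥0)
    (R : Set 𝕏) : Set 𝕏 :=
  {x | (f x : ℝ≥0∞) = J P X f δ x R}

/-- The best response `Θ(R) = S_R ∪ (I_R ∩ R)`. -/
def Theta (P : Kernel 𝕏 Ω) (X : ℝ≥0 → Ω → 𝕏) (f : 𝕏 → ℝ≥0) (δ : ℝ≥0 → ℝ≥0)
    (R : Set 𝕏) : Set 𝕏 :=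
  stoppingRegion P X f δ R ∪ (indifferenceRegion P X f δ R ∩ R)

/-- A Borel set `R ⊆ 𝕏` is an equilibrium if `Θ(R) = R`. -/
def IsEquilibrium (P : Kernel 𝕏 Ω) (X : ℝ≥0 → Ω → 𝕏) (f : 𝕏 → ℝ≥0) (δ : ℝ≥0 → ℝ≥0)
    (R : Set 𝕏) : Prop :=
  MeasurableSet R ∧ Theta P X f δ R = R

/-- The value `V(x, R) = f(x) ∨ J(x, R)`. -/
def V (P : Kernel 𝕏 Ω) (X : ℝ≥0 → Ω → 𝕏) (f : 𝕏 → ℝ≥0) (δ : ℝ≥0 → ℝ≥0)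
    (x : 𝕏) (R : Set 𝕏) : ℝ≥0∞ :=
  max (f x : ℝ≥0∞) (J P X f δ x R)

/-- An optimal equilibrium: an equilibrium whose value dominates that of every equilibrium at
every state. -/
def IsOptimalEquilibrium (P : Kernel 𝕏 Ω) (X : ℝ≥0 → Ω → 𝕏) (f : 𝕏 → ℝ≥0) (δ : ℝ≥0 → ℝ≥0)
    (R' : Set 𝕏) : Prop :=
  IsEquilibrium P X f δ R' ∧
    ∀ R, IsEquilibrium P X f δ R → ∀ x, V P X f δ x R ≤ V P X f δ x R'

/-- The intersection of all equilibria that are closed (in `𝕏`). -/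
def Rstar (P : Kernel 𝕏 Ω) (X : ℝ≥0 → Ω → 𝕏) (f : 𝕏 → ℝ≥0) (δ : ℝ≥0 → ℝ≥0) : Set 𝕏 :=
  ⋂₀ {R | IsEquilibrium P X f δ R ∧ IsClosed R}

end StopEq

end

/-! Since the process moves at once strictly above and below its position, a path that reaches the
closure of `R` enters `R` itself immediately, by the intermediate value theorem. Hence `J x R` is
the expected payoff at the first time `t ≥ 0` in `closure R` (`J_eq_lintegral_pay`). So `J` does not
see the passage from `R` to its closure, it equals `f` on `R`, and a Borel set is an equilibrium
exactly when `f ≤ J` everywhere (`isEquilibrium_iff`).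

If `C` is a closed equilibrium, then at any stopping time it is at least as good to wait for the
next visit to `C`: this is `f ≤ J` combined with the strong Markov property and log-subadditivity of
`δ` (`lintegral_pay_le_lintegral_pay_hit`). Visit in turn the sets of a sequence of closed
equilibria in which each set recurs infinitely often. The expected payoffs increase, and the
visiting times increase to the hitting time of the intersection, so dominated convergence gives
`J_le_J_iInter`.

By second countability `Rstar` is such a countable intersection, and the closure of any given
equilibrium can be put first, so `Rstar` dominates every equilibrium. Comparison with the
equilibrium `Set.univ` gives `f ≤ J` for `Rstar`, which makes it an equilibrium. -/

namespace StopEq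

variable {𝕏 : Set ℝ}

/-! ### Hitting times and payoffs of a single path. -/

section Path

open Classical in
/-- The first time `t ≥ s` at which the path `w` is in `C`, and `⊤` if there is none. -/
noncomputable def hit (w : ℝ≥0 → 𝕏) (C : Set 𝕏) (s : WithTop ℝ≥0) : WithTop ℝ≥0 :=
  if ∃ t : ℝ≥0, s ≤ WithTop.some t ∧ w t ∈ C then
    WithTop.some (sInf {t : ℝ≥0 | s ≤ WithTop.some t ∧ w t ∈ C})
  else ⊤

/-- The discounted payoff of stopping the path `w` at time `τ`, with value `0` at `τ = ⊤`. -/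
noncomputable def pay (f : 𝕏 → ℝ≥0) (δ : ℝ≥0 → ℝ≥0) (w : ℝ≥0 → 𝕏) (τ : WithTop ℝ≥0) : ℝ≥0∞ :=
  if τ = ⊤ then 0 else ((δ (τ.untopD 0) * f (w (τ.untopD 0)) : ℝ≥0) : ℝ≥0∞)

variable {f : 𝕏 → ℝ≥0} {δ : ℝ≥0 → ℝ≥0} {w : ℝ≥0 → 𝕏} {C : Set 𝕏} {s : WithTop ℝ≥0} {t : ℝ≥0}

@[simp] lemma pay_top : pay f δ w ⊤ = 0 := if_pos rfl

lemma pay_coe : pay f δ w (WithTop.some t) = ((δ t * f (w t) : ℝ≥0) : ℝ≥0∞) :=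
  if_neg WithTop.coe_ne_top

lemma not_top_le_some (t : ℝ≥0) : ¬ (⊤ : WithTop ℝ≥0) ≤ WithTop.some t :=
  not_le.2 (WithTop.coe_lt_top t)

lemma hit_le (hs : s ≤ WithTop.some t) (ht : w t ∈ C) : hit w C s ≤ WithTop.some t := by
  rw [hit, if_pos ⟨t, hs, ht⟩]
  exact WithTop.coe_le_coe.2 (csInf_le (OrderBot.bddBelow _) ⟨hs, ht⟩)

lemma le_hit : s ≤ hit w C s := by
  unfold hit
  split_ifs with h
  · induction s with
    | top => exact absurd h.choose_spec.1 (not_top_le_some _)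
    | coe s =>
      exact WithTop.coe_le_coe.2 (le_csInf h fun b hb => WithTop.coe_le_coe.1 hb.1)
  · exact le_top

lemma mem_of_hit_eq (hw : Continuous w) (hC : IsClosed C) (h : hit w C s = WithTop.some t) :
    s ≤ WithTop.some t ∧ w t ∈ C := by
  unfold hit at h
  split_ifs at h with hex
  · induction s with
    | top => exact absurd hex.choose_spec.1 (not_top_le_some _)
    | coe s =>
      have hcl : IsClosed {t : ℝ≥0 | WithTop.some s ≤ WithTop.some t ∧ w t ∈ C} := by
        simp only [WithTop.coe_le_coe]
        exact isClosed_Ici.inter (hC.preimage hw)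
      have := hcl.csInf_mem hex (OrderBot.bddBelow _)
      rwa [WithTop.coe_inj.1 h] at this
  · exact absurd h WithTop.top_ne_coe

lemma hit_le_iff (hw : Continuous w) (hC : IsClosed C) :
    hit w C s ≤ WithTop.some t ↔ ∃ u ≤ t, s ≤ WithTop.some u ∧ w u ∈ C := by
  constructor
  · intro h
    obtain ⟨u, hu⟩ := WithTop.ne_top_iff_exists.1 (ne_top_of_le_ne_top WithTop.coe_ne_top h)
    rw [← hu] at h
    exact ⟨u, WithTop.coe_le_coe.1 h, mem_of_hit_eq hw hC hu.symm⟩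
  · rintro ⟨u, hut, hsu, hu⟩
    exact (hit_le hsu hu).trans (WithTop.coe_le_coe.2 hut)

lemma hit_shift (hw : Continuous w) (hC : IsClosed C) (r : ℝ≥0)
    (h : hit (fun u => w (r + u)) C 0 = WithTop.some t) :
    hit w C (WithTop.some r) = WithTop.some (r + t) := by
  have hw' : Continuous fun u => w (r + u) := by fun_prop
  have hm := (mem_of_hit_eq hw' hC h).2
  have hle : hit w C (WithTop.some r) ≤ WithTop.some (r + t) := hit_le (WithTop.coe_le_coe.2 le_self_add) hm
  refine le_antisymm hle ?_
  obtain ⟨v, hv⟩ := WithTop.ne_top_iff_exists.1 (ne_top_of_le_ne_top WithTop.coe_ne_top hle)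
  rw [← hv]
  obtain ⟨hrv, hvC⟩ := mem_of_hit_eq hw hC hv.symm
  obtain ⟨u, rfl⟩ := exists_add_of_le (WithTop.coe_le_coe.1 hrv)
  have : hit (fun u => w (r + u)) C 0 ≤ WithTop.some u := hit_le bot_le hvC
  rw [h] at this
  exact WithTop.coe_le_coe.2 (add_le_add_right (WithTop.coe_le_coe.1 this) r)

/-- Pathwise form of log-subadditivity: discounting afresh from time `r` never beats discounting
from time `0`. -/
lemma mul_pay_shift_le (hδ : IsDiscount δ) (hw : Continuous w) (hC : IsClosed C) (r : ℝ≥0) :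
    (δ r : ℝ≥0∞) * pay f δ (fun u => w (r + u)) (hit (fun u => w (r + u)) C 0)
      ≤ pay f δ w (hit w C (WithTop.some r)) := by
  rcases eq_or_ne (hit (fun u => w (r + u)) C 0) ⊤ with h | h
  · simp [h]
  · obtain ⟨t, ht⟩ := WithTop.ne_top_iff_exists.1 h
    rw [← ht, hit_shift hw hC r ht.symm, pay_coe, pay_coe, ← ENNReal.coe_mul, ENNReal.coe_le_coe,
      ← mul_assoc]
    gcongr
    rcases eq_or_ne r 0 with rfl | hr
    · simp [hδ.zero]
    rcases eq_or_ne t 0 with rfl | ht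
    · simp [hδ.zero]
    exact hδ.log_subadditive r t (pos_iff_ne_zero.2 hr) (pos_iff_ne_zero.2 ht)

end Path

/-! ### Measurability of hitting times and payoffs. -/

section Measurability

variable {Ω : Type*} [MeasurableSpace Ω] {X : ℝ≥0 → Ω → 𝕏} {C : Set 𝕏}

/-- Reduces a visit to `C` to countably many conditions. A visit at `u < t` is approximated by dense
times to the right of `u`, which keeps them above `s`; a visit at `t` leaves no such room, hence
`insert t D`. The converse is compactness of a time interval. -/
lemma exists_mem_Icc_closed_iff {w : ℝ≥0 → 𝕏} (hw : Continuous w) (hC : IsClosed C)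
    {D : Set ℝ≥0} (hD : Dense D) (s : WithTop ℝ≥0) (t : ℝ≥0) :
    (∃ u ≤ t, s ≤ WithTop.some u ∧ w u ∈ C) ↔
      ∀ n : ℕ, ∃ u ∈ insert t D, u ≤ t ∧ s ≤ WithTop.some u ∧ Metric.infEDist (w u) C < (n + 1 : ℝ≥0∞)⁻¹ := by
  have hcont : Continuous fun u => Metric.infEDist (w u) C :=
    Metric.continuous_infEDist.comp hw
  constructor
  · rintro ⟨u, hut, hsu, hu⟩ n
    have h0 : Metric.infEDist (w u) C < (n + 1 : ℝ≥0∞)⁻¹ := by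
      rw [Metric.infEDist_zero_of_mem hu]
      simp
    rcases hut.eq_or_lt with rfl | hlt
    · exact ⟨u, by simp, le_rfl, hsu, h0⟩
    · have hev : ∀ᶠ v in 𝓝[>] u, Metric.infEDist (w v) C < (n + 1 : ℝ≥0∞)⁻¹ :=
        nhdsWithin_le_nhds (hcont.continuousAt.eventually_lt continuousAt_const h0)
      obtain ⟨b, hb, hsub⟩ := (mem_nhdsGT_iff_exists_Ioo_subset' hlt).1 hev
      obtain ⟨v, hvD, hv⟩ := hD.exists_between (lt_min hb hlt)
      exact ⟨v, by simp [hvD], hv.2.le.trans (min_le_right _ _),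
        hsu.trans (WithTop.coe_le_coe.2 hv.1.le), hsub ⟨hv.1, hv.2.trans_le (min_le_left _ _)⟩⟩
  · intro h
    choose u _ hut hsu hu using h
    obtain ⟨v, hv, φ, hφ, hlim⟩ :=
      (isCompact_Icc (a := (s.untopD 0)) (b := t)).tendsto_subseq (x := u) fun n =>
        ⟨by
          induction s with
          | top => exact absurd (hsu n) (not_top_le_some _)
          | coe s => exact WithTop.coe_le_coe.1 (hsu n), hut n⟩
    refine ⟨v, hv.2, ?_, ?_⟩
    · induction s with
      | top => exact absurd (hsu 0) (not_top_le_some _)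
      | coe s => exact WithTop.coe_le_coe.2 hv.1
    · have h1 : Tendsto (fun n => Metric.infEDist (w (u (φ n))) C) atTop
          (𝓝 (Metric.infEDist (w v) C)) := (hcont.tendsto v).comp hlim
      have h2 : Tendsto (fun n => Metric.infEDist (w (u (φ n))) C) atTop (𝓝 0) := by
        refine tendsto_of_tendsto_of_tendsto_of_le_of_le tendsto_const_nhds
          (ENNReal.tendsto_inv_nat_nhds_zero) (fun _ => zero_le) fun n => ?_
        refine (hu (φ n)).le.trans (ENNReal.inv_le_inv.2 ?_)
        exact_mod_cast (hφ.id_le n).trans (Nat.le_succ _)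
      exact (Metric.mem_iff_infEDist_zero_of_closed hC).2 (tendsto_nhds_unique h1 h2)

lemma isStoppingTime_hit {ℱ : Filtration ℝ≥0 ‹MeasurableSpace Ω›}
    (hX : ∀ t, Measurable[ℱ t] (X t)) (hc : ∀ ω, Continuous fun t => X t ω) (hC : IsClosed C)
    {τ : Ω → WithTop ℝ≥0} (hτ : IsStoppingTime ℱ τ) :
    IsStoppingTime ℱ fun ω => hit (fun t => X t ω) C (τ ω) := by
  intro t
  obtain ⟨D, hDc, hD⟩ := TopologicalSpace.exists_countable_dense ℝ≥0
  have : {ω | hit (fun t => X t ω) C (τ ω) ≤ WithTop.some t} = ⋂ n : ℕ, ⋃ u ∈ insert t D, {ω | u ≤ t ∧ τ ω ≤ WithTop.some u ∧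
      Metric.infEDist (X u ω) C < (n + 1 : ℝ≥0∞)⁻¹} := by
    ext ω
    simp only [Set.mem_ofPred_eq, hit_le_iff (hc ω) hC, exists_mem_Icc_closed_iff (hc ω) hC hD,
      Set.mem_iInter, Set.mem_iUnion, exists_prop]
  rw [this]
  refine MeasurableSet.iInter fun n => MeasurableSet.biUnion (hDc.insert t) fun u _ => ?_
  by_cases hut : u ≤ t
  · simp only [hut, true_and]
    refine MeasurableSet.inter (ℱ.mono hut _ (hτ u)) (ℱ.mono hut _ ?_)
    exact measurableSet_lt (Metric.continuous_infEDist.measurable.comp (hX u)) measurable_const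
  · simp [hut]

lemma measurable_pay {f : 𝕏 → ℝ≥0} (hf : Continuous f) {δ : ℝ≥0 → ℝ≥0} (hδ : Continuous δ)
    (hX : ∀ t, Measurable (X t)) (hc : ∀ ω, Continuous fun t => X t ω)
    {τ : Ω → WithTop ℝ≥0} (hτ : Measurable τ) :
    Measurable fun ω => pay f δ (fun t => X t ω) (τ ω) := by
  have hu : Measurable fun ω => (τ ω).untopD 0 := hτ.untopD 0
  have h := (measurable_uncurry_of_continuous_of_measurable (u := X) hc hX).comp
    (hu.prodMk measurable_id)
  refine Measurable.ite (hτ (measurableSet_singleton ⊤)) measurable_const ?_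
  exact ((hδ.measurable.comp hu).mul (hf.measurable.comp h)).coe_nnreal_ennreal

end Measurability

/-! ### The strong Markov property for functionals of the path. -/

section StrongMarkov

variable {Ω : Type*} [MeasurableSpace Ω] {P : Kernel 𝕏 Ω} {X : ℝ≥0 → Ω → 𝕏}

/-- The space of continuous paths in `𝕏`. -/
abbrev Path (𝕏 : Set ℝ) := {w : ℝ≥0 → 𝕏 // Continuous w}

namespace IsContinuousStrongMarkov

variable (hX : IsContinuousStrongMarkov P X)

/-- The filtration generated by the process. -/
noncomputable abbrev filtration (hX : IsContinuousStrongMarkov P X) :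
    Filtration ℝ≥0 ‹MeasurableSpace Ω› :=
  Filtration.natural X fun t => (hX.measurable t).stronglyMeasurable

/-- The path of the process, as an element of the path space. -/
def path (hX : IsContinuousStrongMarkov P X) (ω : Ω) : Path 𝕏 :=
  ⟨fun t => X t ω, hX.continuous_path ω⟩

/-- The path of the process after the time `τ`. -/
def shiftedPath (hX : IsContinuousStrongMarkov P X) (τ : Ω → WithTop ℝ≥0) (ω : Ω) : Path 𝕏 :=
  ⟨fun t => X ((τ ω).untopD 0 + t) ω, (hX.continuous_path ω).comp (continuous_const_add _)⟩

lemma measurable_uncurry (hX : IsContinuousStrongMarkov P X) :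
    Measurable (Function.uncurry X) :=
  measurable_uncurry_of_continuous_of_measurable hX.continuous_path hX.measurable

lemma measurable_path : Measurable hX.path :=
  Measurable.subtype_mk (measurable_pi_lambda _ hX.measurable)

lemma measurable_filtration (t : ℝ≥0) : Measurable[hX.filtration t] (X t) := by
  have : MeasurableSpace.comap (X t) inferInstance ≤ hX.filtration t :=
    le_iSup₂_of_le t le_rfl le_rfl
  exact (comap_measurable (X t)).mono this le_rfl

variable {τ : Ω → WithTop ℝ≥0}

lemma measurable_shiftedPath (hτ : Measurable τ) : Measurable (hX.shiftedPath τ) := by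
  refine Measurable.subtype_mk (measurable_pi_lambda _ fun t => ?_)
  exact hX.measurable_uncurry.comp (((hτ.untopD 0).add_const t).prodMk measurable_id)

lemma measurable_stopped (hX : IsContinuousStrongMarkov P X) (hτ : Measurable τ) : Measurable fun ω => X ((τ ω).untopD 0) ω :=
  hX.measurable_uncurry.comp ((hτ.untopD 0).prodMk measurable_id)

lemma measure_shiftedPath (x : 𝕏) (hτ : IsStoppingTime hX.filtration τ) {A : Set Ω}
    (hA : MeasurableSet[hτ.measurableSpace] A) {S : Set (Path 𝕏)} (hS : MeasurableSet S) :
    P x (A ∩ {ω | τ ω < ⊤} ∩ hX.shiftedPath τ ⁻¹' S)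
      = ∫⁻ ω in A ∩ {ω | τ ω < ⊤}, P (X ((τ ω).untopD 0) ω) (hX.path ⁻¹' S) ∂(P x) := by
  obtain ⟨B, hB, rfl⟩ := hS
  exact hX.strong_markov x τ hτ A hA B hB

lemma measurableSet_lt_top (hτ : Measurable τ) : MeasurableSet {ω | τ ω < ⊤} :=
  measurableSet_lt hτ measurable_const

lemma setLIntegral_shiftedPath (x : 𝕏) (hτ : IsStoppingTime hX.filtration τ) {A : Set Ω}
    (hA : MeasurableSet[hτ.measurableSpace] A) {G : Path 𝕏 → ℝ≥0∞} (hG : Measurable G) :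
    ∫⁻ ω in A ∩ {ω | τ ω < ⊤}, G (hX.shiftedPath τ ω) ∂(P x)
      = ∫⁻ ω in A ∩ {ω | τ ω < ⊤}, ∫⁻ ω', G (hX.path ω') ∂(P (X ((τ ω).untopD 0) ω)) ∂(P x) := by
  have hτm : Measurable τ := hτ.measurable'
  set μ := (P x).restrict (A ∩ {ω | τ ω < ⊤})
  have hs := hX.measurable_shiftedPath hτm
  have hst := hX.measurable_stopped hτm
  set κ : Kernel Ω (Path 𝕏) := (P.map hX.path).comap _ hst
  have hκ : ∀ ω, κ ω = (P (X ((τ ω).untopD 0) ω)).map hX.path := fun ω => by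
    rw [Kernel.comap_apply, Kernel.map_apply _ hX.measurable_path]
  have key : μ.map (hX.shiftedPath τ) = μ.bind κ := by
    ext S hS
    rw [Measure.map_apply hs hS, Measure.bind_apply hS κ.measurable.aemeasurable,
      Measure.restrict_apply (hs hS), Set.inter_comm, hX.measure_shiftedPath x hτ hA hS]
    refine lintegral_congr fun ω => ?_
    rw [hκ, Measure.map_apply hX.measurable_path hS]
  rw [← lintegral_map hG hs, key, Measure.lintegral_bind κ.measurable.aemeasurable hG.aemeasurable]
  refine lintegral_congr fun ω => ?_
  rw [hκ, lintegral_map hG hX.measurable_path]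

/-- The future functional and its conditional mean have the same integral over every event of the
past, so as densities they define the same measure on the σ-algebra of `τ`; a factor `Z` measurable
for it can then be integrated. -/
lemma setLIntegral_mul_shiftedPath (x : 𝕏) (hτ : IsStoppingTime hX.filtration τ)
    {Z : Ω → ℝ≥0∞} (hZ : Measurable[hτ.measurableSpace] Z)
    {G : Path 𝕏 → ℝ≥0∞} (hG : Measurable G) :
    ∫⁻ ω in {ω | τ ω < ⊤}, Z ω * G (hX.shiftedPath τ ω) ∂(P x)
      = ∫⁻ ω in {ω | τ ω < ⊤},
          Z ω * ∫⁻ ω', G (hX.path ω') ∂(P (X ((τ ω).untopD 0) ω)) ∂(P x) := by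
  have hτm : Measurable τ := hτ.measurable'
  have hle := hτ.measurableSpace_le
  have h1 : Measurable fun ω => G (hX.shiftedPath τ ω) := hG.comp (hX.measurable_shiftedPath hτm)
  have h2 : Measurable fun ω => ∫⁻ ω', G (hX.path ω') ∂(P (X ((τ ω).untopD 0) ω)) :=
    (hG.comp hX.measurable_path).lintegral_kernel.comp (hX.measurable_stopped hτm)
  set μ := (P x).restrict {ω | τ ω < ⊤}
  have key : (μ.withDensity fun ω => G (hX.shiftedPath τ ω)).trim hle
      = (μ.withDensity fun ω => ∫⁻ ω', G (hX.path ω') ∂(P (X ((τ ω).untopD 0) ω))).trim hle := by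
    refine @Measure.ext _ hτ.measurableSpace _ _ fun A hA => ?_
    rw [trim_measurableSet_eq hle hA, trim_measurableSet_eq hle hA,
      withDensity_apply _ (hle A hA), withDensity_apply _ (hle A hA),
      Measure.restrict_restrict (hle A hA)]
    exact hX.setLIntegral_shiftedPath x hτ hA hG
  have h := congrArg (fun ν => @lintegral _ hτ.measurableSpace ν Z) key
  simp only [lintegral_trim hle hZ] at h
  rw [lintegral_withDensity_eq_lintegral_mul _ h1 (hZ.mono hle le_rfl),
    lintegral_withDensity_eq_lintegral_mul _ h2 (hZ.mono hle le_rfl)] at h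
  simpa only [Pi.mul_apply, mul_comm] using h

end IsContinuousStrongMarkov

end StrongMarkov

/-! ### Immediate entry from the closure, and the characterisation of equilibria. -/

section Diffusive

variable {Ω : Type*} [MeasurableSpace Ω]

lemma measurableSet_exists_lt_pos {Y : ℝ≥0 → Ω → ℝ} (hY : ∀ t, Measurable (Y t))
    (hc : ∀ ω, Continuous fun t => Y t ω) (ε : ℝ≥0) :
    MeasurableSet {ω | ∃ t < ε, 0 < Y t ω} := by
  obtain ⟨D, hDc, hD⟩ := TopologicalSpace.exists_countable_dense ℝ≥0
  have : {ω | ∃ t < ε, 0 < Y t ω} = ⋃ t ∈ D, {ω | t < ε ∧ 0 < Y t ω} := by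
    ext ω
    simp only [Set.mem_ofPred_eq, Set.mem_iUnion, exists_prop]
    constructor
    · rintro ⟨t, ht, hpos⟩
      obtain ⟨u, hu, huD⟩ := hD.inter_open_nonempty ({u | u < ε} ∩ {u | 0 < Y u ω})
        ((isOpen_lt continuous_id continuous_const).inter
          (isOpen_lt continuous_const (hc ω))) ⟨t, ht, hpos⟩
      exact ⟨u, huD, hu⟩
    · rintro ⟨t, -, ht⟩
      exact ⟨t, ht⟩
  rw [this]
  refine MeasurableSet.biUnion hDc fun t _ => ?_
  by_cases ht : t < ε
  · simpa only [ht, true_and] using measurableSet_lt measurable_const (hY t)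
  · simp [ht]

/-- The paths which immediately go strictly above and strictly below their starting point. -/
def diffusivePaths (𝕏 : Set ℝ) : Set (Path 𝕏) :=
  {w | ∀ n : ℕ, (∃ t < (n + 1 : ℝ≥0)⁻¹, 0 < (w.1 t : ℝ) - w.1 0) ∧
    ∃ t < (n + 1 : ℝ≥0)⁻¹, 0 < (w.1 0 : ℝ) - w.1 t}

lemma measurable_eval (t : ℝ≥0) : Measurable fun w : Path 𝕏 => w.1 t :=
  (measurable_pi_apply t).comp measurable_subtype_coe

lemma measurableSet_diffusivePaths : MeasurableSet (diffusivePaths 𝕏) := by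
  have h (t : ℝ≥0) : Measurable fun w : Path 𝕏 => (w.1 t : ℝ) :=
    measurable_subtype_coe.comp (measurable_eval t)
  have hc (w : Path 𝕏) : Continuous fun t => (w.1 t : ℝ) := continuous_subtype_val.comp w.2
  simp only [diffusivePaths, Set.ofPred_forall, Set.ofPred_and]
  refine MeasurableSet.iInter fun n => MeasurableSet.inter ?_ ?_
  · exact measurableSet_exists_lt_pos (Y := fun t (w : Path 𝕏) => (w.1 t : ℝ) - w.1 0)
      (fun t => (h t).sub (h 0)) (fun w => (hc w).sub continuous_const) _
  · exact measurableSet_exists_lt_pos (Y := fun t (w : Path 𝕏) => (w.1 0 : ℝ) - w.1 t)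
      (fun t => (h 0).sub (h t)) (fun w => continuous_const.sub (hc w)) _

/-- Before time `ε` the path takes values on both sides of `w.1 0`; some point of `R` lies strictly
between them, and continuity in time forces the path through it. -/
lemma exists_mem_of_mem_diffusivePaths {w : Path 𝕏} (hw : w ∈ diffusivePaths 𝕏) {R : Set 𝕏}
    (h0 : w.1 0 ∈ closure R) {ε : ℝ≥0} (hε : 0 < ε) : ∃ t, 0 < t ∧ t < ε ∧ w.1 t ∈ R := by
  obtain ⟨n, hn⟩ : ∃ n : ℕ, (n + 1 : ℝ≥0)⁻¹ < ε := by
    simpa only [one_div] using exists_nat_one_div_lt hε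
  obtain ⟨⟨a, ha, hwa⟩, b, hb, hwb⟩ := hw n
  have hc : Continuous fun t => (w.1 t : ℝ) := continuous_subtype_val.comp w.2
  obtain ⟨r, ⟨hra, hrb⟩, hr⟩ := mem_closure_iff.1 h0
    ({r | (r : ℝ) < w.1 a} ∩ {r | (w.1 b : ℝ) < r})
    ((isOpen_lt continuous_subtype_val continuous_const).inter
      (isOpen_lt continuous_const continuous_subtype_val)) ⟨sub_pos.1 hwa, sub_pos.1 hwb⟩
  obtain ⟨t, ht, htr⟩ := intermediate_value_uIcc (a := b) (b := a) hc.continuousOn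
    (Set.Icc_subset_uIcc ⟨le_of_lt hrb, le_of_lt hra⟩)
  refine ⟨t, lt_of_lt_of_le ?_ ht.1, (ht.2.trans_lt (max_lt hb ha)).trans hn, ?_⟩
  · refine lt_min (pos_iff_ne_zero.2 ?_) (pos_iff_ne_zero.2 ?_)
    · rintro rfl; simp at hwb
    · rintro rfl; simp at hwa
  · rwa [Subtype.ext htr]

variable {P : Kernel 𝕏 Ω} {X : ℝ≥0 → Ω → 𝕏}

namespace IsContinuousStrongMarkov

variable (hX : IsContinuousStrongMarkov P X)

lemma ae_exists_lt_pos [IsMarkovKernel P] {Y : ℝ≥0 → Ω → ℝ} (hY : ∀ t, Measurable (Y t))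
    (hc : ∀ ω, Continuous fun t => Y t ω) (x : 𝕏) {S : ℝ≥0 → Set Ω}
    (hS : ∀ t, 0 < t → P x (S t) = 1) (hSY : ∀ t, ∀ ω ∈ S t, ∃ u ≤ t, 0 < Y u ω)
    (ε : ℝ≥0) (hε : 0 < ε) : ∀ᵐ ω ∂(P x), ∃ t < ε, 0 < Y t ω := by
  have hm := measurableSet_exists_lt_pos hY hc ε
  refine (mem_ae_iff_prob_eq_one hm).2 (le_antisymm prob_le_one ?_)
  -- `S` controls times `u ≤ t`, so halving `ε` gives the strict bound; `S t` need not be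
  -- measurable, since only monotonicity of the measure is used.
  rw [← hS (ε / 2) (half_pos hε)]
  refine measure_mono fun ω hω => ?_
  obtain ⟨u, hu, hpos⟩ := hSY _ ω hω
  exact ⟨u, hu.trans_lt (half_lt_self hε), hpos⟩

lemma ae_path_mem_diffusivePaths [IsMarkovKernel P] (hdiff : IsDiffusive P X) (x : 𝕏) :
    ∀ᵐ ω ∂(P x), hX.path ω ∈ diffusivePaths 𝕏 := by
  have hm (t : ℝ≥0) : Measurable fun ω => (X t ω : ℝ) :=
    measurable_subtype_coe.comp (hX.measurable t)
  have hc (ω : Ω) : Continuous fun t => (X t ω : ℝ) :=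
    continuous_subtype_val.comp (hX.continuous_path ω)
  have hne (t : ℝ≥0) (ω : Ω) : ((fun s => (X s ω : ℝ)) '' Set.Icc 0 t).Nonempty :=
    ⟨_, 0, ⟨le_rfl, zero_le⟩, rfl⟩
  have h1 := fun n : ℕ => ae_exists_lt_pos (P := P) (Y := fun t ω => (X t ω : ℝ) - x)
    (fun t => (hm t).sub measurable_const) (fun ω => (hc ω).sub continuous_const) x
    (fun t ht => (hdiff x t ht).1) (fun t ω hω => by
      obtain ⟨_, ⟨u, hu, rfl⟩, hlt⟩ := exists_lt_of_lt_csSup (hne t ω) hω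
      exact ⟨u, hu.2, sub_pos.2 hlt⟩) (n + 1 : ℝ≥0)⁻¹ (by positivity)
  have h2 := fun n : ℕ => ae_exists_lt_pos (P := P) (Y := fun t ω => (x : ℝ) - X t ω)
    (fun t => measurable_const.sub (hm t)) (fun ω => continuous_const.sub (hc ω)) x
    (fun t ht => (hdiff x t ht).2) (fun t ω hω => by
      obtain ⟨_, ⟨u, hu, rfl⟩, hlt⟩ := exists_lt_of_csInf_lt (hne t ω) hω
      exact ⟨u, hu.2, sub_pos.2 hlt⟩) (n + 1 : ℝ≥0)⁻¹ (by positivity)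
  filter_upwards [ae_all_iff.2 h1, ae_all_iff.2 h2, hX.start x] with ω h1 h2 h0 n
  subst h0
  exact ⟨h1 n, h2 n⟩

lemma isStoppingTime_hit_zero {C : Set 𝕏} (hC : IsClosed C) :
    IsStoppingTime hX.filtration fun ω => hit (fun t => X t ω) C 0 :=
  isStoppingTime_hit hX.measurable_filtration hX.continuous_path hC
    (isStoppingTime_const hX.filtration 0)

lemma ae_shiftedPath_mem_diffusivePaths [IsMarkovKernel P] (hdiff : IsDiffusive P X) (x : 𝕏)
    {τ : Ω → WithTop ℝ≥0} (hτ : IsStoppingTime hX.filtration τ) :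
    ∀ᵐ ω ∂(P x), τ ω < ⊤ → hX.shiftedPath τ ω ∈ diffusivePaths 𝕏 := by
  have h := hX.measure_shiftedPath x hτ (A := Set.univ) MeasurableSet.univ
    measurableSet_diffusivePaths.compl
  have h0 : ∀ y : 𝕏, P y (hX.path ⁻¹' (diffusivePaths 𝕏)ᶜ) = 0 := fun y =>
    hX.ae_path_mem_diffusivePaths hdiff y
  simp only [h0, lintegral_zero] at h
  rw [ae_iff, ← h]
  congr 1
  ext ω
  simp

end IsContinuousStrongMarkov

lemma payoff_rho_eq_pay {Ω : Type*} {X : ℝ≥0 → Ω → 𝕏} {f : 𝕏 → ℝ≥0} {δ : ℝ≥0 → ℝ≥0} {R : Set 𝕏} {ω : Ω}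
    (hlim : Tendsto (fun t : ℝ≥0 => δ t * f (X t ω)) atTop (𝓝 0))
    (h : ∀ t : ℝ≥0, hit (fun t => X t ω) (closure R) 0 = WithTop.some t →
      ∀ ε > 0, ∃ u, 0 < u ∧ u < ε ∧ X (t + u) ω ∈ R) :
    payoff X f δ (rho X R ω) ω
      = pay f δ (fun t => X t ω) (hit (fun t => X t ω) (closure R) 0) := by
  rcases eq_or_ne (hit (fun t => X t ω) (closure R) 0) ⊤ with htop | hne
  · have hrho : rho X R ω = ∞ := by
      have : {t | 0 < t ∧ X t ω ∈ R} = ∅ := by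
        refine Set.eq_empty_of_forall_notMem fun t ht => ?_
        have := hit_le (w := fun t => X t ω) (s := 0) (t := t) bot_le (subset_closure ht.2)
        rw [htop] at this
        exact not_top_le_some _ this
      rw [rho, this, Set.image_empty, sInf_empty]
    rw [htop, pay_top, payoff, if_pos hrho]
    refine Tendsto.limsup_eq ?_
    simpa using ENNReal.tendsto_coe.2 hlim
  · obtain ⟨t, ht⟩ := WithTop.ne_top_iff_exists.1 hne
    have hrho : rho X R ω = (t : ℝ≥0∞) := by
      refine le_antisymm (ENNReal.le_of_forall_pos_le_add fun ε hε _ => ?_) ?_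
      · obtain ⟨u, hu, huε, hR⟩ := h t ht.symm ε hε
        have : rho X R ω ≤ ((t + u : ℝ≥0) : ℝ≥0∞) :=
          sInf_le ⟨t + u, ⟨by positivity, hR⟩, rfl⟩
        refine this.trans ?_
        rw [ENNReal.coe_add]
        gcongr
      · refine le_sInf ?_
        rintro _ ⟨u, ⟨-, hu⟩, rfl⟩
        have := hit_le (w := fun t => X t ω) (s := 0) (t := u) bot_le (subset_closure hu)
        rw [← ht] at this
        exact ENNReal.coe_le_coe.2 (WithTop.coe_le_coe.1 this)
    rw [← ht, pay_coe, hrho, payoff, if_neg ENNReal.coe_ne_top, ENNReal.toNNReal_coe]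

namespace IsContinuousStrongMarkov

variable [IsMarkovKernel P] {f : 𝕏 → ℝ≥0} {δ : ℝ≥0 → ℝ≥0}

/-- By the strong Markov property at the hitting time of `closure R`, the path after that time is
again diffusive, so it meets `R` at arbitrarily small positive later times. If the closure is never
hit, both payoffs vanish. -/
lemma J_eq_lintegral_pay (hX : IsContinuousStrongMarkov P X) (hdiff : IsDiffusive P X)
    (hlim : ∀ x : 𝕏, ∀ᵐ ω ∂(P x), Tendsto (fun t : ℝ≥0 => δ t * f (X t ω)) atTop (𝓝 0))
    (x : 𝕏) (R : Set 𝕏) :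
    J P X f δ x R
      = ∫⁻ ω, pay f δ (hX.path ω).1 (hit (hX.path ω).1 (closure R) 0) ∂(P x) := by
  refine lintegral_congr_ae ?_
  filter_upwards [hlim x, hX.ae_shiftedPath_mem_diffusivePaths hdiff x
    (hX.isStoppingTime_hit_zero (isClosed_closure (s := R)))] with ω hω hd
  refine payoff_rho_eq_pay hω fun t ht ε hε => ?_
  have hmem := (mem_of_hit_eq (hX.continuous_path ω) isClosed_closure ht).2
  rw [ht] at hd
  have hd := hd (WithTop.coe_lt_top t)
  have h0 : X ((WithTop.some t).untopD 0 + 0) ω ∈ closure R := by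
    rw [add_zero]
    exact hmem
  rw [← ht] at h0
  obtain ⟨u, hu0, huε, hu⟩ := exists_mem_of_mem_diffusivePaths hd h0 hε
  refine ⟨u, hu0, huε, ?_⟩
  change X ((hit (fun t => X t ω) (closure R) 0).untopD 0 + u) ω ∈ R at hu
  rw [ht] at hu
  exact hu

lemma J_closure (hX : IsContinuousStrongMarkov P X) (hdiff : IsDiffusive P X)
    (hlim : ∀ x : 𝕏, ∀ᵐ ω ∂(P x), Tendsto (fun t : ℝ≥0 => δ t * f (X t ω)) atTop (𝓝 0))
    (x : 𝕏) (R : Set 𝕏) : J P X f δ x (closure R) = J P X f δ x R := by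
  rw [hX.J_eq_lintegral_pay hdiff hlim, hX.J_eq_lintegral_pay hdiff hlim, closure_closure]

lemma J_of_mem (hX : IsContinuousStrongMarkov P X) (hδ : IsDiscount δ) (hdiff : IsDiffusive P X)
    (hlim : ∀ x : 𝕏, ∀ᵐ ω ∂(P x), Tendsto (fun t : ℝ≥0 => δ t * f (X t ω)) atTop (𝓝 0))
    {x : 𝕏} {R : Set 𝕏} (hx : x ∈ R) : J P X f δ x R = f x := by
  rw [hX.J_eq_lintegral_pay hdiff hlim]
  have : ∀ᵐ ω ∂(P x), pay f δ (hX.path ω).1 (hit (hX.path ω).1 (closure R) 0) = f x := by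
    filter_upwards [hX.start x] with ω hω
    have h0 : hit (hX.path ω).1 (closure R) 0 = WithTop.some 0 := by
      refine le_antisymm (hit_le le_rfl ?_) bot_le
      change X 0 ω ∈ closure R
      rw [hω]
      exact subset_closure hx
    rw [h0, pay_coe, hδ.zero, one_mul]
    change (f (X 0 ω) : ℝ≥0∞) = _
    rw [hω]
  rw [lintegral_congr_ae this, lintegral_const, measure_univ, mul_one]

/-- On `R` indifference is automatic by `J_of_mem`, so `R` is an equilibrium iff the stopping region
is empty. -/
lemma isEquilibrium_iff (hX : IsContinuousStrongMarkov P X) (hδ : IsDiscount δ)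
    (hdiff : IsDiffusive P X)
    (hlim : ∀ x : 𝕏, ∀ᵐ ω ∂(P x), Tendsto (fun t : ℝ≥0 => δ t * f (X t ω)) atTop (𝓝 0))
    {R : Set 𝕏} :
    IsEquilibrium P X f δ R ↔ MeasurableSet R ∧ ∀ x, (f x : ℝ≥0∞) ≤ J P X f δ x R := by
  refine and_congr_right fun _ => ⟨fun h x => ?_, fun h => ?_⟩
  · by_contra! hx
    have hxR : x ∈ R := h ▸ Or.inl hx
    exact hx.ne (hX.J_of_mem hδ hdiff hlim hxR)
  · ext x
    constructor
    · rintro (hx | hx)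
      · exact absurd (h x) (not_le.2 hx)
      · exact hx.2
    · exact fun hx => Or.inr ⟨(hX.J_of_mem hδ hdiff hlim hx).symm, hx⟩

end IsContinuousStrongMarkov

end Diffusive

lemma measurable_pay_hit {f : 𝕏 → ℝ≥0} (hf : Continuous f) {δ : ℝ≥0 → ℝ≥0} (hδ : Continuous δ)
    {C : Set 𝕏} (hC : IsClosed C) : Measurable fun w : Path 𝕏 => pay f δ w.1 (hit w.1 C 0) := by
  refine measurable_pay (X := fun t (w : Path 𝕏) => w.1 t) hf hδ measurable_eval (fun w => w.2) ?_
  -- For the constant filtration a stopping time is just a measurable time.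
  exact (isStoppingTime_hit (ℱ := Filtration.const ℝ≥0 inferInstance le_rfl) measurable_eval
    (fun w => w.2) hC (isStoppingTime_const _ 0)).measurable'

/-! ### Visiting a sequence of closed sets in turn. -/

section SuccessiveHitting

/-- The times at which the path `w` successively hits `C 0`, `C 1`, `C 2`, .... -/
noncomputable def hitSeq (C : ℕ → Set 𝕏) (w : ℝ≥0 → 𝕏) : ℕ → WithTop ℝ≥0
  | 0 => 0
  | n + 1 => hit w (C n) (hitSeq C w n)

variable {C : ℕ → Set 𝕏} {w : ℝ≥0 → 𝕏} {f : 𝕏 → ℝ≥0} {δ : ℝ≥0 → ℝ≥0}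

lemma hitSeq_mono : Monotone (hitSeq C w) := monotone_nat_of_le_succ fun _ => le_hit

lemma hitSeq_le_hit_iInter (hw : Continuous w) (hC : ∀ n, IsClosed (C n)) (n : ℕ) :
    hitSeq C w n ≤ hit w (⋂ n, C n) 0 := by
  rcases eq_or_ne (hit w (⋂ n, C n) 0) ⊤ with h | h
  · exact h ▸ le_top
  obtain ⟨t, ht⟩ := WithTop.ne_top_iff_exists.1 h
  have hmem := (mem_of_hit_eq hw (isClosed_iInter hC) ht.symm).2
  rw [← ht]
  induction n with
  | zero => exact bot_le
  | succ n ih => exact hit_le ih (Set.mem_iInter.1 hmem n)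

/-- If a visiting time is infinite or the times are unbounded, the intersection is never hit and the
payoffs tend to `0`. Otherwise the times converge to some `u`; as each set recurs and is closed, `w
u` lies in all of them, so `u` is the hitting time of the intersection. -/
lemma tendsto_pay_hitSeq (hw : Continuous w) (hC : ∀ n, IsClosed (C n))
    (hfreq : ∀ n, ∃ᶠ m in atTop, C m = C n) (hf : Continuous f) (hδ : Continuous δ)
    (hlim : Tendsto (fun t : ℝ≥0 => δ t * f (w t)) atTop (𝓝 0)) :
    Tendsto (fun n => pay f δ w (hitSeq C w n)) atTop
      (𝓝 (pay f δ w (hit w (⋂ n, C n) 0))) := by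
  by_cases hfin : ∃ n, hitSeq C w n = ⊤
  · obtain ⟨n, hn⟩ := hfin
    have htop : hit w (⋂ n, C n) 0 = ⊤ := top_le_iff.1 (hn ▸ hitSeq_le_hit_iInter hw hC n)
    rw [htop, pay_top]
    refine tendsto_const_nhds.congr' ?_
    filter_upwards [eventually_ge_atTop n] with m hm
    have hm' : hitSeq C w m = ⊤ := top_le_iff.1 (hn ▸ hitSeq_mono hm)
    rw [hm', pay_top]
  push Not at hfin
  choose t ht using fun n => WithTop.ne_top_iff_exists.1 (hfin n)
  have htmono : Monotone t := fun m n hmn => WithTop.coe_le_coe.1 <| by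
    rw [ht, ht]; exact hitSeq_mono hmn
  have htmem (n : ℕ) : w (t (n + 1)) ∈ C n := (mem_of_hit_eq hw (hC n) (ht (n + 1)).symm).2
  simp only [← ht, pay_coe]
  rcases tendsto_atTop_of_monotone htmono with hlim' | ⟨u, hu⟩
  · have htop : hit w (⋂ n, C n) 0 = ⊤ := by
      by_contra h
      obtain ⟨v, hv⟩ := WithTop.ne_top_iff_exists.1 h
      obtain ⟨n, hn⟩ := (hlim'.eventually_gt_atTop v).exists
      have := hitSeq_le_hit_iInter hw hC n
      rw [← ht, ← hv] at this
      exact absurd (WithTop.coe_le_coe.1 this) (not_le.2 hn)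
    rw [htop, pay_top]
    exact ENNReal.tendsto_coe.2 (hlim.comp hlim')
  · have hmem : w u ∈ ⋂ n, C n := by
      refine Set.mem_iInter.2 fun n => ?_
      refine (hC n).mem_of_frequently_of_tendsto ?_
        ((hw.tendsto u).comp (hu.comp (tendsto_add_atTop_nat 1)))
      exact (hfreq n).mono fun m hm => hm ▸ htmem m
    have hhit : hit w (⋂ n, C n) 0 = WithTop.some u := by
      have hle : hit w (⋂ n, C n) 0 ≤ WithTop.some u := hit_le bot_le hmem
      refine le_antisymm hle ?_
      obtain ⟨v, hv⟩ := WithTop.ne_top_iff_exists.1 (ne_top_of_le_ne_top WithTop.coe_ne_top hle)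
      rw [← hv]
      refine WithTop.coe_le_coe.2 (le_of_tendsto' hu fun n => WithTop.coe_le_coe.1 ?_)
      rw [ht, hv]
      exact hitSeq_le_hit_iInter hw hC n
    rw [hhit, pay_coe]
    exact ENNReal.tendsto_coe.2
      (((hδ.mul (hf.comp hw)).tendsto u).comp hu)

lemma pay_le_iSup (τ : WithTop ℝ≥0) :
    pay f δ w τ ≤ ⨆ t : ℝ≥0, ((δ t * f (w t) : ℝ≥0) : ℝ≥0∞) := by
  induction τ with
  | top => rw [pay_top]; exact zero_le
  | coe t => rw [pay_coe]; exact le_iSup (fun t : ℝ≥0 => ((δ t * f (w t) : ℝ≥0) : ℝ≥0∞)) t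

end SuccessiveHitting

/-! ### Monotonicity of the value under intersection of closed equilibria. -/

section Comparison

variable {Ω : Type*} [MeasurableSpace Ω] {P : Kernel 𝕏 Ω}
  {X : ℝ≥0 → Ω → 𝕏} {f : 𝕏 → ℝ≥0} {δ : ℝ≥0 → ℝ≥0}

namespace IsContinuousStrongMarkov

lemma lintegral_pay_le_lintegral_pay_hit [IsMarkovKernel P] (hX : IsContinuousStrongMarkov P X) (hf : Continuous f)
    (hδ : IsDiscount δ) (hdiff : IsDiffusive P X)
    (hlim : ∀ x : 𝕏, ∀ᵐ ω ∂(P x), Tendsto (fun t : ℝ≥0 => δ t * f (X t ω)) atTop (𝓝 0))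
    {C : Set 𝕏} (hC : IsClosed C) (hCJ : ∀ y, (f y : ℝ≥0∞) ≤ J P X f δ y C)
    {τ : Ω → WithTop ℝ≥0} (hτ : IsStoppingTime hX.filtration τ) (x : 𝕏) :
    ∫⁻ ω, pay f δ (hX.path ω).1 (τ ω) ∂(P x)
      ≤ ∫⁻ ω, pay f δ (hX.path ω).1 (hit (hX.path ω).1 C (τ ω)) ∂(P x) := by
  have hτm : Measurable τ := hτ.measurable'
  have hms := measurableSet_lt_top hτm
  have hZ : Measurable[hτ.measurableSpace] fun ω => (δ ((τ ω).untopD 0) : ℝ≥0∞) :=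
    (hδ.continuous.measurable.comp ((WithTop.measurable_untopD 0).comp
      hτ.measurable)).coe_nnreal_ennreal
  calc ∫⁻ ω, pay f δ (hX.path ω).1 (τ ω) ∂(P x)
      = ∫⁻ ω in {ω | τ ω < ⊤}, pay f δ (hX.path ω).1 (τ ω) ∂(P x) := by
        rw [← lintegral_indicator hms]
        refine lintegral_congr fun ω => ?_
        by_cases h : τ ω = ⊤
        · simp [h]
        · simp [Set.indicator, lt_top_iff_ne_top, h]
    _ ≤ ∫⁻ ω in {ω | τ ω < ⊤}, (δ ((τ ω).untopD 0) : ℝ≥0∞) *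
          ∫⁻ ω', pay f δ (hX.path ω').1 (hit (hX.path ω').1 C 0)
            ∂(P (X ((τ ω).untopD 0) ω)) ∂(P x) := by
        -- Uses `f ≤ J` for `C` at the stopped position.
        refine setLIntegral_mono' hms fun ω hω => ?_
        have hlt : τ ω < ⊤ := hω
        rw [pay, if_neg hlt.ne, ENNReal.coe_mul]
        gcongr
        refine (hCJ _).trans_eq ?_
        rw [hX.J_eq_lintegral_pay hdiff hlim, hC.closure_eq]
        rfl
    _ = ∫⁻ ω in {ω | τ ω < ⊤}, (δ ((τ ω).untopD 0) : ℝ≥0∞) *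
          pay f δ (hX.shiftedPath τ ω).1 (hit (hX.shiftedPath τ ω).1 C 0) ∂(P x) :=
        (hX.setLIntegral_mul_shiftedPath x hτ hZ (measurable_pay_hit hf hδ.continuous hC)).symm
    _ ≤ ∫⁻ ω in {ω | τ ω < ⊤},
          pay f δ (hX.path ω).1 (hit (hX.path ω).1 C (τ ω)) ∂(P x) := by
        refine setLIntegral_mono' hms fun ω hω => ?_
        obtain ⟨r, hr⟩ := WithTop.ne_top_iff_exists.1 (show τ ω < ⊤ from hω).ne
        have := mul_pay_shift_le (f := f) hδ (hX.path ω).2 hC r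
        simp only [shiftedPath, ← hr]
        exact this
    _ ≤ _ := setLIntegral_le_lintegral _ _

lemma isStoppingTime_hitSeq (hX : IsContinuousStrongMarkov P X) {C : ℕ → Set 𝕏}
    (hC : ∀ n, IsClosed (C n)) (n : ℕ) :
    IsStoppingTime hX.filtration fun ω => hitSeq C (hX.path ω).1 n := by
  induction n with
  | zero => exact isStoppingTime_const hX.filtration 0
  | succ n ih =>
    exact isStoppingTime_hit hX.measurable_filtration hX.continuous_path (hC n) ih

variable [IsMarkovKernel P]

/-- The value of a closed set `C 0` is at most that of `⋂ n, C n`, if stopping at any of the closed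
sets `C n` is at least as good as stopping immediately. -/
lemma J_le_J_iInter (hX : IsContinuousStrongMarkov P X) (hf : Continuous f)
    (hδ : IsDiscount δ) (hdiff : IsDiffusive P X)
    (hlim : ∀ x : 𝕏, ∀ᵐ ω ∂(P x), Tendsto (fun t : ℝ≥0 => δ t * f (X t ω)) atTop (𝓝 0))
    (hint : ∀ x : 𝕏, ∫⁻ ω, ⨆ t : ℝ≥0, ((δ t * f (X t ω) : ℝ≥0) : ℝ≥0∞) ∂(P x) < ∞)
    {C : ℕ → Set 𝕏} (hC : ∀ n, IsClosed (C n)) (hfreq : ∀ n, ∃ᶠ m in atTop, C m = C n)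
    (hCJ : ∀ n y, (f y : ℝ≥0∞) ≤ J P X f δ y (C n)) (x : 𝕏) :
    J P X f δ x (C 0) ≤ J P X f δ x (⋂ n, C n) := by
  rw [hX.J_eq_lintegral_pay hdiff hlim, hX.J_eq_lintegral_pay hdiff hlim, (hC 0).closure_eq,
    (isClosed_iInter hC).closure_eq]
  have hmono : Monotone fun n => ∫⁻ ω, pay f δ (hX.path ω).1 (hitSeq C (hX.path ω).1 n) ∂(P x) :=
    monotone_nat_of_le_succ fun n => hX.lintegral_pay_le_lintegral_pay_hit hf hδ hdiff hlim
      (hC n) (hCJ n) (hX.isStoppingTime_hitSeq hC n) x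
  have htends : Tendsto
      (fun n => ∫⁻ ω, pay f δ (hX.path ω).1 (hitSeq C (hX.path ω).1 n) ∂(P x)) atTop
      (𝓝 (∫⁻ ω, pay f δ (hX.path ω).1 (hit (hX.path ω).1 (⋂ n, C n) 0) ∂(P x))) := by
    refine tendsto_lintegral_of_dominated_convergence
      (fun ω => ⨆ t : ℝ≥0, ((δ t * f (X t ω) : ℝ≥0) : ℝ≥0∞)) (fun n => ?_)
      (fun n => Eventually.of_forall fun ω => pay_le_iSup _) (hint x).ne ?_
    · exact measurable_pay hf hδ.continuous hX.measurable hX.continuous_path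
        (hX.isStoppingTime_hitSeq hC n).measurable'
    · filter_upwards [hlim x] with ω hω
      exact tendsto_pay_hitSeq (hX.continuous_path ω) hC hfreq hf hδ.continuous hω
  -- Index `1` is the hitting time of `C 0` from time `0`.
  exact hmono.ge_of_tendsto htends 1

lemma J_le_J_Rstar (hX : IsContinuousStrongMarkov P X) (hf : Continuous f)
    (hδ : IsDiscount δ) (hdiff : IsDiffusive P X)
    (hlim : ∀ x : 𝕏, ∀ᵐ ω ∂(P x), Tendsto (fun t : ℝ≥0 => δ t * f (X t ω)) atTop (𝓝 0))
    (hint : ∀ x : 𝕏, ∫⁻ ω, ⨆ t : ℝ≥0, ((δ t * f (X t ω) : ℝ≥0) : ℝ≥0∞) ∂(P x) < ∞)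
    {R : Set 𝕏} (hR : IsEquilibrium P X f δ R) (x : 𝕏) :
    J P X f δ x R ≤ J P X f δ x (Rstar P X f δ) := by
  set S : Set (Set 𝕏) := {R | IsEquilibrium P X f δ R ∧ IsClosed R} with hS
  have hRS : closure R ∈ S := by
    refine ⟨(hX.isEquilibrium_iff hδ hdiff hlim).2 ⟨isClosed_closure.measurableSet, fun y => ?_⟩,
      isClosed_closure⟩
    rw [hX.J_closure hdiff hlim]
    exact ((hX.isEquilibrium_iff hδ hdiff hlim).1 hR).2 y
  have : Nonempty S := ⟨⟨closure R, hRS⟩⟩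
  -- An intersection of closed sets in a second countable space is already a countable one.
  obtain ⟨D, hD⟩ := eq_closed_inter_nat (fun s : S => (s : Set 𝕏)) fun s => s.2.2
  let E : ℕ → S := fun n => Nat.casesOn n ⟨closure R, hRS⟩ D
  -- Unpairing repeats each set infinitely often; as `0` unpairs to `(0, 0)`, `C 0` is still
  -- `closure R`.
  let C : ℕ → Set 𝕏 := fun n => (E n.unpair.1).1
  have hCS (n : ℕ) : C n ∈ S := (E _).2
  have hinter : ⋂ n, C n = Rstar P X f δ := by
    refine Set.Subset.antisymm ?_ fun y hy => Set.mem_iInter.2 fun n => hy _ (hCS n)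
    rw [Rstar, ← hS, Set.sInter_eq_iInter, ← hD]
    refine fun y hy => Set.mem_iInter.2 fun k => ?_
    have := Set.mem_iInter.1 hy (Nat.pair (k + 1) 0)
    simpa [C, E] using this
  have hfreq (n : ℕ) : ∃ᶠ m in atTop, C m = C n := by
    refine frequently_atTop.2 fun N => ⟨Nat.pair n.unpair.1 N, Nat.right_le_pair _ _, ?_⟩
    simp [C]
  have h0 : C 0 = closure R := by simp [C, E]
  rw [← hX.J_closure hdiff hlim, ← h0, ← hinter]
  exact hX.J_le_J_iInter hf hδ hdiff hlim hint (fun n => (hCS n).2) hfreq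
    (fun n => ((hX.isEquilibrium_iff hδ hdiff hlim).1 (hCS n).1).2) x

end IsContinuousStrongMarkov

end Comparison

end StopEq

theorem theorem4p1 (𝕏 : Set ℝ) (h𝕏 : 𝕏.OrdConnected)
    {Ω : Type*} [MeasurableSpace Ω] (P : Kernel 𝕏 Ω) [IsMarkovKernel P]
    (X : ℝ≥0 → Ω → 𝕏) (hX : StopEq.IsContinuousStrongMarkov P X)
    (f : 𝕏 → ℝ≥0) (hf : Continuous f)
    (δ : ℝ≥0 → ℝ≥0) (hδ : StopEq.IsDiscount δ)
    (hdiff : StopEq.IsDiffusive P X)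
    (hlim : ∀ x : 𝕏, ∀ᵐ ω ∂(P x), Tendsto (fun t : ℝ≥0 => δ t * f (X t ω)) atTop (𝓝 0))
    (hint : ∀ x : 𝕏, ∫⁻ ω, ⨆ t : ℝ≥0, ((δ t * f (X t ω) : ℝ≥0) : ℝ≥0∞) ∂(P x) < ∞) :
    StopEq.IsOptimalEquilibrium P X f δ (StopEq.Rstar P X f δ) := by
  have hle {R : Set 𝕏} (hR : StopEq.IsEquilibrium P X f δ R) (x : 𝕏) :=
    hX.J_le_J_Rstar hf hδ hdiff hlim hint hR x
  -- Stopping everywhere is an equilibrium; dominating it yields `f ≤ J` for `Rstar`.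
  have huniv : StopEq.IsEquilibrium P X f δ Set.univ :=
    (hX.isEquilibrium_iff hδ hdiff hlim).2
      ⟨MeasurableSet.univ, fun x => (hX.J_of_mem hδ hdiff hlim (Set.mem_univ x)).ge⟩
  have hclosed : IsClosed (StopEq.Rstar P X f δ) := isClosed_sInter fun _ hR => hR.2
  refine ⟨(hX.isEquilibrium_iff hδ hdiff hlim).2 ⟨hclosed.measurableSet, fun x => ?_⟩,
    fun R hR x => max_le_max le_rfl (hle hR x)⟩
  exact (((hX.isEquilibrium_iff hδ hdiff hlim).1 huniv).2 x).trans (hle huniv x)
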